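/- Let $\Omega\subset\mathbb{C}$ be open. A function $k:\Omega^2\to\mathbb{C}$ is a positive definite kernel on $\Omega$ if $\sum_{i,j=1}^n k(x_i,x_j)\,\xi_i\,\overline{\xi_j}\ge 0$ (in particular, the sum is real) for every $n\in\mathbb{N}$, all $x_1,\dots,x_n\in\Omega$ and all $\xi_1,\dots,\xi_n\in\mathbb{C}$. For an open set $\mathcal{U}\subset\Omega^2$, say that $k$ is sesquiholomorphic on $\mathcal{U}$ if there is a separately holomorphic function $g$ on the open set $\mathcal{U}^*=\{(x,y)\in\mathbb{C}^2:(x,\overline{y})\in\mathcal{U}\}$ such that $k(u,v)=g(u,\overline{v})$ for all $(u,v)\in\mathcal{U}$; that is, $k$ is separately holomorphic in $u$ and anti-holomorphic in $v$ on $\mathcal{U}$. Here separately holomorphic means holomorphic in each variable when the other one is held fixed; no joint continuity is assumed. **Theorem (Propagation of regularity, complex context).** Let $\Omega\subset\mathbb{C}$ be open and let $k:\Omega^2\to\mathbb{C}$ be a positive definite kernel on $\Omega$. If $k$ is sesquiholomorphic on some open set $\mathcal{U}\subset\Omega^2$ containing the diagonal $\{(x,x):x\in\Omega\}$, then $k$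 is sesquiholomorphic on all of $\Omega^2$; that is, $k$ is a holomorphic positive definite kernel (a holomorphic reproducing kernel) in $\Omega$. -/

import Mathlib

open scoped ComplexOrder ComplexConjugate

/-- `k` is a positive definite kernel on `Ω`: for all finite families `x j ∈ Ω`, `ξ j ∈ ℂ`, the
complex number `∑ i, j, k (x i, x j) * ξ i * conj (ξ j)` is real and nonnegative (which is what
`0 ≤ z` means for a complex number `z`). Only the values of `k` on `Ω × Ω` matter. -/
def IsPosDefKernelOn {X : Type*} (k : X × X → ℂ) (Ω : Set X) : Prop :=
  ∀ (n : ℕ) (x : Fin n → X) (ξ : Fin n → ℂ), (∀ j, x j ∈ Ω) →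
    0 ≤ ∑ i, ∑ j, k (x i, x j) * ξ i * conj (ξ j)

/-- `g` is separately holomorphic on the (open) set `W ⊆ ℂ²`: each of its partial functions is
holomorphic on the corresponding (open) slice of `W`. -/
def SeparatelyHolomorphicOn (g : ℂ × ℂ → ℂ) (W : Set (ℂ × ℂ)) : Prop :=
  (∀ y : ℂ, DifferentiableOn ℂ (fun x => g (x, y)) {x | (x, y) ∈ W}) ∧
    ∀ x : ℂ, DifferentiableOn ℂ (fun y => g (x, y)) {y | (x, y) ∈ W}

/-- The sesquiconjugate set `{(x, y) : (x, conj y) ∈ U}` of `U ⊆ ℂ²`. -/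
def sesquiconjugate (U : Set (ℂ × ℂ)) : Set (ℂ × ℂ) :=
  {p | (p.1, conj p.2) ∈ U}

/-- `k` is sesquiholomorphic on the (open) set `U ⊆ ℂ²`: `k (u, v) = g (u, conj v)` on `U` for some
separately holomorphic function `g` on the sesquiconjugate set of `U`. -/
def SesquiholomorphicOn (k : ℂ × ℂ → ℂ) (U : Set (ℂ × ℂ)) : Prop :=
  ∃ g : ℂ × ℂ → ℂ, SeparatelyHolomorphicOn g (sesquiconjugate U) ∧
    ∀ u v : ℂ, (u, v) ∈ U → k (u, v) = g (u, conj v)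

/-- `k` is a holomorphic positive definite kernel (holomorphic reproducing kernel) in the (open)
set `Ω ⊆ ℂ`. -/
def IsHolomorphicPosDefKernelOn (k : ℂ × ℂ → ℂ) (Ω : Set ℂ) : Prop :=
  IsPosDefKernelOn k Ω ∧ SesquiholomorphicOn k (Ω ×ˢ Ω)

/-! By Cauchy–Schwarz, |∑ k(xᵢ, w) ξᵢ|² is at most k(w, w) times the kernel's quadratic form at
(xᵢ), (ξᵢ). Hence every section k(·, w), even for w far away, is controlled near u₀ by k near (u₀,
u₀). Choose the ξᵢ so that the sum is the difference of the slopes at u₀ towards z and z'. The form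
is then a mixed second difference of g, of size O(|z - z'|²) by the Schwarz lemma in each variable.
Slopes are thus Lipschitz and converge, so sections are holomorphic; Hermitian symmetry handles the
other variable.

The Schwarz estimates need g locally bounded, which is Hartogs' theorem: Baire bounds g on a thin
bidisc, and Hartogs' lemma for the Taylor coefficients widens it. -/

open MeasureTheory Metric Set Filter Topology Real

/-! ### Subharmonicity of `log⁺ ‖f‖` and Hartogs' lemma -/

/-- Sub-mean value property of `log⁺ ‖f‖` on the unit circle. -/
theorem posLog_norm_zero_le_circleAverage {f : ℂ → ℂ}
    (hf : AnalyticOnNhd ℂ f (closedBall 0 1)) :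
    log⁺ ‖f 0‖ ≤ circleAverage (fun z => log⁺ ‖f z‖) 0 1 := by
  have h1 : AnalyticOnNhd ℂ f (closedBall 0 |1|) := by simpa using hf
  have hs : sphere (0 : ℂ) |1| ⊆ closedBall 0 1 := by simpa using sphere_subset_closedBall
  have hnonneg : 0 ≤ circleAverage (fun z => log⁺ ‖f z‖) 0 1 :=
    circleAverage_nonneg_of_nonneg fun z _ => posLog_nonneg
  rw [posLog_apply]
  refine max_le hnonneg ?_
  by_cases h0 : f 0 = 0
  · simpa [h0] using hnonneg
  have hmer := (hf.mono hs).meromorphicOn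
  calc Real.log ‖f 0‖ ≤ circleAverage (Real.log ‖f ·‖) 0 1 := by
        -- Jensen's formula: each zero in the unit disc contributes a nonnegative term.
        rw [AnalyticOnNhd.circleAverage_log_norm one_ne_zero h1 h0]
        refine le_add_of_nonneg_left (finsum_nonneg fun u => ?_)
        by_cases hu : u ∈ closedBall (0 : ℂ) |1|
        · refine mul_nonneg (by exact_mod_cast MeromorphicOn.AnalyticOnNhd.divisor_nonneg h1 u) ?_
          rcases eq_or_ne u 0 with rfl | hu0
          · simp
          · refine Real.log_nonneg ?_
            rw [zero_sub, norm_neg, one_mul]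
            exact (one_le_inv₀ (norm_pos_iff.2 hu0)).2 (by simpa using hu)
        · rw [Function.locallyFinsuppWithin.apply_eq_zero_of_notMem _ hu]
          simp
    _ ≤ _ := by
        refine circleAverage_mono hmer.circleIntegrable_log_norm hmer.circleIntegrable_posLog_norm
          fun z _ => ?_
        exact le_max_right _ _

/-- Sub-mean value property of `log⁺ ‖f‖` over discs. -/
theorem volume_ball_mul_posLog_norm_le_lintegral {f : ℂ → ℂ} {c : ℂ} {R : ℝ}
    (hf : DifferentiableOn ℂ f (ball c R)) :
    volume (ball c R) * ENNReal.ofReal (log⁺ ‖f c‖) ≤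
      ∫⁻ z in ball c R, ENNReal.ofReal (log⁺ ‖f z‖) := by
  set h : ℂ → ENNReal := (ball (0 : ℂ) R).indicator fun w => ENNReal.ofReal (log⁺ ‖f (c + w)‖)
    with hh
  have hmaps : ∀ w ∈ ball (0 : ℂ) R, c + w ∈ ball c R := fun w hw => by simpa using hw
  have hmeas : Measurable h := by
    classical
    have hc : ContinuousOn (fun w => ENNReal.ofReal (log⁺ ‖f (c + w)‖)) (ball 0 R) := by
      have : ContinuousOn (fun w => f (c + w)) (ball 0 R) :=
        hf.continuousOn.comp (by fun_prop) hmaps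
      exact ENNReal.continuous_ofReal.comp_continuousOn
        (continuous_posLog.comp_continuousOn this.norm)
    have := hc.measurable_piecewise (g := fun _ => (0 : ENNReal)) continuousOn_const
      measurableSet_ball
    rw [hh, ← Set.piecewise_eq_indicator]
    exact this
  have hint : ∫⁻ z in ball c R, ENNReal.ofReal (log⁺ ‖f z‖) = ∫⁻ w, h w := by
    rw [← lintegral_indicator measurableSet_ball, ← lintegral_add_left_eq_self _ c]
    refine lintegral_congr fun w => ?_
    by_cases hw : w ∈ ball (0 : ℂ) R
    · rw [hh, indicator_of_mem hw, indicator_of_mem (hmaps w hw)]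
    · rw [hh, indicator_of_notMem hw, indicator_of_notMem]
      simpa using hw
  -- Rotation invariance and Tonelli turn circle means into area means without polar coordinates.
  have hrot : ∀ θ : ℝ, ∫⁻ w, h (circleMap 0 1 θ * w) = ∫⁻ w, h w := fun θ => by
    have := (rotation (Circle.exp θ)).measurePreserving.lintegral_comp hmeas
    simpa [rotation_apply, circleMap] using this
  have hmean : ∀ w, ∫⁻ _ in Ioc 0 (2 * π),
      (ball (0 : ℂ) R).indicator (fun _ => ENNReal.ofReal (log⁺ ‖f c‖)) w ≤
        ∫⁻ θ in Ioc 0 (2 * π), h (circleMap 0 1 θ * w) := fun w => by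
    by_cases hw : w ∈ ball (0 : ℂ) R
    · have hθ : ∀ θ : ℝ, circleMap 0 1 θ * w ∈ ball (0 : ℂ) R := fun θ => by simpa using hw
      have hF : AnalyticOnNhd ℂ (fun z => f (c + z * w)) (closedBall 0 1) := by
        intro z hz
        have hzw : c + z * w ∈ ball c R := by
          simp only [mem_ball, dist_self_add_left, norm_mul] at hw ⊢
          simp only [mem_closedBall, dist_zero_right] at hz hw
          nlinarith [norm_nonneg w]
        exact (hf.analyticAt (isOpen_ball.mem_nhds hzw)).comp_of_eq (by fun_prop) rfl
      have := posLog_norm_zero_le_circleAverage hF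
      have hsub : sphere (0 : ℂ) |1| ⊆ closedBall 0 1 := by simpa using sphere_subset_closedBall
      have hI := (hF.mono hsub).meromorphicOn.circleIntegrable_posLog_norm
      have hI' := (intervalIntegrable_iff_integrableOn_Ioc_of_le two_pi_pos.le).1 hI
      simp only [zero_mul, add_zero, circleAverage, smul_eq_mul] at this
      rw [intervalIntegral.integral_of_le two_pi_pos.le, inv_mul_eq_div,
        le_div_iff₀ two_pi_pos] at this
      rw [indicator_of_mem hw, setLIntegral_const, Real.volume_Ioc, sub_zero,
        ← ENNReal.ofReal_mul posLog_nonneg]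
      refine (ENNReal.ofReal_le_ofReal this).trans ?_
      rw [ofReal_integral_eq_lintegral_ofReal hI' (ae_of_all _ fun _ => posLog_nonneg)]
      refine (lintegral_congr fun θ => ?_).le
      rw [hh, indicator_of_mem (hθ θ)]
    · simp [hw]
  have hkey : ENNReal.ofReal (2 * π) * (volume (ball c R) * ENNReal.ofReal (log⁺ ‖f c‖)) ≤
      ENNReal.ofReal (2 * π) * ∫⁻ w, h w := by
    have hswap : ∫⁻ w, ∫⁻ θ in Ioc 0 (2 * π), h (circleMap 0 1 θ * w) =
        ∫⁻ θ in Ioc 0 (2 * π), ∫⁻ w, h (circleMap 0 1 θ * w) :=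
      lintegral_lintegral_swap (hmeas.comp (((continuous_circleMap 0 1).comp continuous_snd).mul
        continuous_fst).measurable).aemeasurable
    have h1 := lintegral_mono (μ := volume) hmean
    rw [hswap] at h1
    simp only [hrot, setLIntegral_const, Real.volume_Ioc, sub_zero] at h1
    rw [lintegral_mul_const' _ _ ENNReal.ofReal_ne_top, lintegral_indicator measurableSet_ball,
      setLIntegral_const] at h1
    rwa [mul_comm, mul_comm (ENNReal.ofReal (2 * π)) (∫⁻ w, h w), mul_comm (volume _),
      Measure.addHaar_ball_center]
  rw [hint]
  exact (ENNReal.mul_le_mul_iff_right (by simpa using pi_pos) ENNReal.ofReal_ne_top).1 hkey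

/-- **Hartogs' lemma** for a sequence of holomorphic functions of at most geometric growth that is
pointwise bounded. -/
theorem eventually_norm_le_exp_of_pointwise_bounded {f : ℕ → ℂ → ℂ} {c : ℂ} {R R' A B ε : ℝ}
    (hf : ∀ m, DifferentiableOn ℂ (f m) (ball c R)) (hR' : R' < R)
    (hgeom : ∀ m, ∀ z ∈ ball c R, ‖f m z‖ ≤ A * B ^ m)
    (hpt : ∀ z ∈ ball c R, ∃ N, ∀ m, ‖f m z‖ ≤ N) (hε : 0 < ε) :
    ∀ᶠ m in atTop, ∀ z ∈ ball c R', ‖f m z‖ ≤ exp (ε * m) := by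
  set F : ℕ → ℂ → ENNReal := fun m z => ENNReal.ofReal (log⁺ ‖f m z‖ / m) with hF
  have hFeq : ∀ m z, F m z = ENNReal.ofReal (m : ℝ)⁻¹ * ENNReal.ofReal (log⁺ ‖f m z‖) :=
    fun m z => by
      rw [← ENNReal.ofReal_mul (by positivity), hF]
      simp only [inv_mul_eq_div]
  have hmeas : ∀ m, AEMeasurable (F m) (volume.restrict (ball c R)) := fun m => by
    have h1 : ContinuousOn (F m) (ball c R) :=
      ENNReal.continuous_ofReal.comp_continuousOn
        ((continuous_posLog.comp_continuousOn (hf m).continuousOn.norm).div_const _)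
    exact h1.aemeasurable measurableSet_ball
  have hlim : Tendsto (fun m => ∫⁻ z in ball c R, F m z) atTop (𝓝 0) := by
    have := tendsto_lintegral_of_dominated_convergence' (μ := volume.restrict (ball c R))
      (F := F) (f := fun _ => 0) (fun _ => ENNReal.ofReal (log⁺ A + log⁺ B)) hmeas ?_ ?_ ?_
    · simpa using this
    · intro m
      refine (ae_restrict_iff' measurableSet_ball).2 (ae_of_all _ fun z hz => ?_)
      refine ENNReal.ofReal_le_ofReal ?_
      rcases Nat.eq_zero_or_pos m with rfl | hm
      · simpa using add_nonneg (posLog_nonneg (x := A)) (posLog_nonneg (x := B))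
      have hm1 : (1 : ℝ) ≤ m := by exact_mod_cast hm
      rw [div_le_iff₀ (by positivity)]
      calc log⁺ ‖f m z‖ ≤ log⁺ (A * B ^ m) := posLog_le_posLog (norm_nonneg _) (hgeom m z hz)
        _ ≤ log⁺ A + m * log⁺ B := by simpa using posLog_mul (x := A) (y := B ^ m)
        _ ≤ _ := by nlinarith [posLog_nonneg (x := A)]
    · rw [setLIntegral_const]
      exact ENNReal.mul_ne_top ENNReal.ofReal_ne_top measure_ball_lt_top.ne
    · refine (ae_restrict_iff' measurableSet_ball).2 (ae_of_all _ fun z hz => ?_)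
      obtain ⟨N, hN⟩ := hpt z hz
      have : Tendsto (fun m : ℕ => log⁺ ‖f m z‖ / m) atTop (𝓝 0) :=
        squeeze_zero (fun m => div_nonneg posLog_nonneg (by positivity))
          (fun m => by gcongr; exact hN m)
          (tendsto_const_div_atTop_nhds_zero_nat (log⁺ N))
      simpa using ENNReal.tendsto_ofReal this
  -- Discs of radius R - R' centred in `ball c R'` stay in `ball c R`, so one integral bound serves
  -- all z.
  have hpos : 0 < volume (ball (0 : ℂ) (R - R')) * ENNReal.ofReal ε :=
    ENNReal.mul_pos (measure_ball_pos _ _ (by linarith)).ne' (by simpa using hε)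
  filter_upwards [hlim.eventually_lt_const hpos, eventually_gt_atTop 0] with m hm hm0 z hz
  have hsub : ball z (R - R') ⊆ ball c R := ball_subset_ball' (by
    have := mem_ball.1 hz
    linarith)
  have hm0' : (0 : ℝ) < m := by exact_mod_cast hm0
  have h1 : volume (ball (0 : ℂ) (R - R')) * F m z ≤ ∫⁻ w in ball c R, F m w := by
    calc volume (ball (0 : ℂ) (R - R')) * F m z
        = ENNReal.ofReal (m : ℝ)⁻¹ *
            (volume (ball z (R - R')) * ENNReal.ofReal (log⁺ ‖f m z‖)) := by
          rw [hFeq, Measure.addHaar_ball_center volume z]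
          ring
      _ ≤ ENNReal.ofReal (m : ℝ)⁻¹ *
            ∫⁻ w in ball z (R - R'), ENNReal.ofReal (log⁺ ‖f m w‖) := by
          gcongr
          exact volume_ball_mul_posLog_norm_le_lintegral ((hf m).mono hsub)
      _ = ∫⁻ w in ball z (R - R'), F m w := by
          simp only [hFeq]
          rw [lintegral_const_mul' _ _ ENNReal.ofReal_ne_top]
      _ ≤ _ := lintegral_mono_set hsub
  have h2 : F m z < ENNReal.ofReal ε := lt_of_mul_lt_mul_left' (h1.trans_lt hm)
  have h3 := (ENNReal.ofReal_lt_ofReal_iff hε).1 h2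
  rw [div_lt_iff₀ hm0'] at h3
  rcases eq_or_ne (f m z) 0 with h0 | h0
  · simp [h0, exp_nonneg]
  · rw [← Real.log_le_iff_le_exp (norm_pos_iff.2 h0)]
    exact (le_max_right _ _).trans h3.le

/-! ### Schwarz estimates and differentiation in a parameter -/

/-- Schwarz lemma: Lipschitz bound for bounded holomorphic functions. -/
theorem norm_sub_le_of_norm_le_on_ball {f : ℂ → ℂ} {c z : ℂ} {r M : ℝ}
    (hf : DifferentiableOn ℂ f (ball c r)) (hM : ∀ w ∈ ball c r, ‖f w‖ ≤ M) (hz : z ∈ ball c r) :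
    ‖f z - f c‖ ≤ 2 * M / r * ‖z - c‖ := by
  have hc : c ∈ ball c r := mem_ball_self (nonempty_ball.1 ⟨z, hz⟩)
  rw [← dist_eq_norm, ← dist_eq_norm]
  refine Complex.dist_le_div_mul_dist_of_mapsTo_ball hf (fun w hw => ?_) hz
  rw [mem_closedBall, dist_eq_norm]
  linarith [norm_sub_le (f w) (f c), hM w hw, hM c hc]

/-- Schwarz lemma: bound on the difference quotients of a bounded holomorphic function. -/
theorem norm_dslope_le_of_norm_le_on_ball {f : ℂ → ℂ} {c z : ℂ} {r M : ℝ}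
    (hf : DifferentiableOn ℂ f (ball c r)) (hM : ∀ w ∈ ball c r, ‖f w‖ ≤ M) (hz : z ∈ ball c r) :
    ‖dslope f c z‖ ≤ 2 * M / r := by
  have hc : c ∈ ball c r := mem_ball_self (nonempty_ball.1 ⟨z, hz⟩)
  refine Complex.norm_dslope_le_div_of_mapsTo_ball hf (fun w hw => ?_) hz
  rw [mem_closedBall, dist_eq_norm]
  linarith [norm_sub_le (f w) (f c), hM w hw, hM c hc]

/-- `g` is separately holomorphic on `A × V`, and bounded on `N × V` for small neighborhoods `N`
of any point of `A`. -/
structure SeparatelyHolomorphicLocallyBounded (g : ℂ → ℂ → ℂ) (A V : Set ℂ) : Prop where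
  left : ∀ v ∈ V, DifferentiableOn ℂ (fun u => g u v) A
  right : ∀ u ∈ A, DifferentiableOn ℂ (g u) V
  bdd : ∀ x ∈ A, ∃ r > 0, ∃ M, ball x r ⊆ A ∧ ∀ u ∈ ball x r, ∀ v ∈ V, ‖g u v‖ ≤ M

namespace SeparatelyHolomorphicLocallyBounded

variable {g : ℂ → ℂ → ℂ} {A V : Set ℂ}

/-- Slopes in u are holomorphic in v, and the local bound makes them converge uniformly on V. -/
theorem deriv (hA : IsOpen A) (hV : IsOpen V) (h : SeparatelyHolomorphicLocallyBounded g A V) :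
    SeparatelyHolomorphicLocallyBounded (fun u v => deriv (fun x => g x v) u) A V where
  left v hv := (h.left v hv).deriv hA
  right u hu := by
    obtain ⟨r, hr, M, hrA, hM⟩ := h.bdd u hu
    have hd : ∀ v ∈ V, DifferentiableOn ℂ (dslope (fun x => g x v) u) (ball u r) := fun v hv =>
      (Complex.differentiableOn_dslope (ball_mem_nhds u hr)).2 ((h.left v hv).mono hrA)
    have hlip : ∀ x ∈ ball u r, ∀ v ∈ V,
        ‖dslope (fun x => g x v) u x - dslope (fun x => g x v) u u‖ ≤
          2 * (2 * M / r) / r * ‖x - u‖ := fun x hx v hv =>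
      norm_sub_le_of_norm_le_on_ball (hd v hv) (fun w hw => norm_dslope_le_of_norm_le_on_ball
        ((h.left v hv).mono hrA) (fun y hy => hM y hy v hv) hw) hx
    have hmem : ∀ᶠ x in 𝓝[≠] u, x ∈ ball u r :=
      eventually_nhdsWithin_of_eventually_nhds (ball_mem_nhds u hr)
    have hconv : TendstoUniformlyOn (fun x v => dslope (fun x => g x v) u x)
        (fun v => _root_.deriv (fun x => g x v) u) (𝓝[≠] u) V := by
      rw [Metric.tendstoUniformlyOn_iff]
      intro ε hε
      have hlim : Tendsto (fun x => 2 * (2 * M / r) / r * ‖x - u‖) (𝓝[≠] u) (𝓝 0) := by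
        have : Continuous fun x : ℂ => 2 * (2 * M / r) / r * ‖x - u‖ := by fun_prop
        simpa using (this.tendsto u).mono_left nhdsWithin_le_nhds
      filter_upwards [hmem, hlim.eventually_lt_const hε] with x hx hxε v hv
      rw [dist_comm, dist_eq_norm, ← dslope_same]
      exact (hlip x hx v hv).trans_lt hxε
    refine hconv.tendstoLocallyUniformlyOn.differentiableOn ?_ hV
    filter_upwards [hmem, self_mem_nhdsWithin] with x hx hxu
    simp only [dslope_of_ne _ hxu, slope_def_module]
    exact ((h.right x (hrA hx)).sub (h.right u hu)).const_smul (x - u)⁻¹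
  bdd x hx := by
    obtain ⟨r, hr, M, hrA, hM⟩ := h.bdd x hx
    refine ⟨r / 2, by positivity, M / (r / 4), (ball_subset_ball (by linarith)).trans hrA,
      fun u hu v hv => ?_⟩
    have hsub : closedBall u (r / 4) ⊆ ball x r := fun z hz => by
      have := mem_closedBall.1 hz
      have := mem_ball.1 hu
      exact mem_ball.2 (by linarith [dist_triangle z u x])
    refine Complex.norm_deriv_le_of_forall_mem_sphere_norm_le (by positivity) ?_
      fun z hz => hM z (hsub (sphere_subset_closedBall hz)) v hv
    refine DifferentiableOn.diffContOnCl ?_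
    rw [closure_ball _ (by positivity)]
    exact (h.left v hv).mono (hsub.trans hrA)

theorem iteratedDeriv (hA : IsOpen A) (hV : IsOpen V)
    (h : SeparatelyHolomorphicLocallyBounded g A V) (n : ℕ) :
    SeparatelyHolomorphicLocallyBounded (fun u v => iteratedDeriv n (fun x => g x v) u) A V := by
  induction n with
  | zero => simpa using h
  | succ n ih => simpa [iteratedDeriv_succ] using ih.deriv hA hV

end SeparatelyHolomorphicLocallyBounded

/-! ### Hartogs' theorem: local boundedness -/

/-- **Hartogs' theorem**, bounded version: a separately holomorphic function on a bidisc that is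
bounded on a thinner bidisc is bounded on all smaller bidiscs. -/
theorem exists_bound_of_separately_holomorphic {g : ℂ → ℂ → ℂ} {a b : ℂ} {r R R' S S' M : ℝ}
    (hr : 0 < r) (hrR : r ≤ R) (hR' : R' < R) (hS' : S' < S)
    (hleft : ∀ v ∈ ball b S, DifferentiableOn ℂ (fun u => g u v) (ball a R))
    (hright : ∀ u ∈ ball a r, DifferentiableOn ℂ (g u) (ball b S))
    (hM : ∀ u ∈ ball a r, ∀ v ∈ ball b S, ‖g u v‖ ≤ M) :
    ∃ M', ∀ u ∈ ball a R', ∀ v ∈ ball b S', ‖g u v‖ ≤ M' := by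
  rcases le_or_gt R' 0 with hR0 | hR0
  · exact ⟨0, fun u hu => by simp [ball_eq_empty.2 hR0] at hu⟩
  have hshlb : SeparatelyHolomorphicLocallyBounded g (ball a r) (ball b S) :=
    ⟨fun v hv => (hleft v hv).mono (ball_subset_ball hrR), hright, fun x hx => by
      obtain ⟨δ, hδ, hsub⟩ := isOpen_iff.1 isOpen_ball x hx
      exact ⟨δ, hδ, M, hsub, fun u hu v hv => hM u (hsub hu) v hv⟩⟩
  set co : ℕ → ℂ → ℂ := fun m v =>
    (m.factorial : ℂ)⁻¹ * iteratedDeriv m (fun x => g x v) a with hco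
  have hcodiff : ∀ m, DifferentiableOn ℂ (co m) (ball b S) := fun m =>
    ((hshlb.iteratedDeriv isOpen_ball isOpen_ball m).right a (mem_ball_self hr)).const_mul _
  have hcauchy : ∀ ρ > 0, ∀ v, ∀ C, DifferentiableOn ℂ (fun u => g u v) (closedBall a ρ) →
      (∀ z ∈ sphere a ρ, ‖g z v‖ ≤ C) → ∀ m, ‖co m v‖ ≤ C / ρ ^ m := by
    intro ρ hρ v C hd hC m
    have := Complex.norm_iteratedDeriv_le_of_forall_mem_sphere_norm_le (f := fun u => g u v) m hρ
      (DifferentiableOn.diffContOnCl (by rwa [closure_ball _ hρ.ne'])) hC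
    rw [hco, norm_mul, norm_inv, Complex.norm_natCast,
      inv_mul_le_iff₀ (by exact_mod_cast m.factorial_pos), ← mul_div_assoc]
    exact this
  -- R' < R₂ < R₁ < R: Cauchy's estimate on R₁ is pointwise in v, Hartogs' lemma makes it uniform at
  -- the cost of R₂, and R' / R₂ < 1 gives summability.
  obtain ⟨R₁, hR₁, hR₁R⟩ := exists_between hR'
  obtain ⟨R₂, hR₂, hR₂R⟩ := exists_between hR₁
  have hR₂0 : 0 < R₂ := hR0.trans hR₂
  have hR₁0 : 0 < R₁ := hR₂0.trans hR₂R
  have hgeom : ∀ m, ∀ v ∈ ball b S, ‖(R₁ : ℂ) ^ m * co m v‖ ≤ M * (R₁ / (r / 2)) ^ m := by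
    intro m v hv
    have hsub : closedBall a (r / 2) ⊆ ball a r := closedBall_subset_ball (by linarith)
    have := hcauchy (r / 2) (by positivity) v M
      ((hleft v hv).mono (hsub.trans (ball_subset_ball hrR)))
      (fun z hz => hM z (hsub (sphere_subset_closedBall hz)) v hv) m
    rw [norm_mul, norm_pow, Complex.norm_real, norm_of_nonneg hR₁0.le, div_pow]
    calc R₁ ^ m * ‖co m v‖ ≤ R₁ ^ m * (M / (r / 2) ^ m) := by gcongr
      _ = _ := by ring
  have hpt : ∀ v ∈ ball b S, ∃ N, ∀ m, ‖(R₁ : ℂ) ^ m * co m v‖ ≤ N := by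
    intro v hv
    have hd := (hleft v hv).mono (closedBall_subset_ball hR₁R)
    obtain ⟨N, hN⟩ := (isCompact_sphere a R₁).exists_bound_of_continuousOn
      (hd.continuousOn.mono sphere_subset_closedBall)
    refine ⟨N, fun m => ?_⟩
    have := hcauchy R₁ hR₁0 v N hd hN m
    rw [norm_mul, norm_pow, Complex.norm_real, norm_of_nonneg hR₁0.le]
    rwa [le_div_iff₀' (by positivity)] at this
  have hε : 0 < Real.log (R₁ / R₂) := Real.log_pos ((one_lt_div hR₂0).2 hR₂R)
  obtain ⟨m₀, hm₀⟩ := eventually_atTop.1 (eventually_norm_le_exp_of_pointwise_bounded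
    (fun m => (hcodiff m).const_mul ((R₁ : ℂ) ^ m)) hS' hgeom hpt hε)
  have hbig : ∀ m ≥ m₀, ∀ v ∈ ball b S', ‖co m v‖ ≤ (R₂⁻¹) ^ m := by
    intro m hm v hv
    have := hm₀ m hm v hv
    rw [mul_comm (Real.log _), exp_nat_mul, exp_log (by positivity), norm_mul, norm_pow,
      Complex.norm_real, norm_of_nonneg hR₁0.le, div_eq_mul_inv, mul_pow] at this
    exact le_of_mul_le_mul_left this (by positivity)
  have hsmall : ∀ m, ∀ v ∈ ball b S', ‖co m v‖ ≤ M * (r / 2)⁻¹ ^ m := by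
    intro m v hv
    have := hgeom m v (ball_subset_ball hS'.le hv)
    rw [norm_mul, norm_pow, Complex.norm_real, norm_of_nonneg hR₁0.le, div_eq_mul_inv, mul_pow]
      at this
    exact le_of_mul_le_mul_left (this.trans_eq (by ring)) (pow_pos hR₁0 m)
  -- The finitely many m < m₀ use the crude thin-bidisc estimate.
  set B : ℕ → ℝ := fun m => (R' / R₂) ^ m +
    if m < m₀ then ‖M‖ * (R' / (r / 2)) ^ m else 0 with hB
  have hBsum : Summable B := by
    refine (summable_geometric_of_lt_one (by positivity) ((div_lt_one hR₂0).2 hR₂)).add ?_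
    refine summable_of_ne_finset_zero (s := Finset.range m₀) fun m hm => ?_
    rw [if_neg (by simpa using hm)]
  refine ⟨∑' m, B m, fun u hu v hv => ?_⟩
  have hts := Complex.hasSum_taylorSeries_on_ball (hleft v (ball_subset_ball hS'.le hv))
    (ball_subset_ball hR'.le hu)
  rw [← hts.tsum_eq]
  refine tsum_of_norm_bounded hBsum.hasSum fun m => ?_
  have hu' : ‖u - a‖ ≤ R' := by simpa [dist_eq_norm] using (mem_ball.1 hu).le
  have hterm : ‖(m.factorial : ℂ)⁻¹ • (u - a) ^ m • iteratedDeriv m (fun u => g u v) a‖ ≤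
      R' ^ m * ‖co m v‖ := by
    rw [hco, norm_smul, norm_smul, norm_pow, norm_mul]
    calc _ = ‖u - a‖ ^ m * (‖(m.factorial : ℂ)⁻¹‖ * ‖iteratedDeriv m (fun u => g u v) a‖) := by
          ring
      _ ≤ _ := by gcongr
  refine hterm.trans ?_
  rcases lt_or_ge m m₀ with hm | hm
  · calc R' ^ m * ‖co m v‖ ≤ R' ^ m * (‖M‖ * (r / 2)⁻¹ ^ m) := by
          gcongr
          exact (hsmall m v hv).trans (by gcongr; exact le_norm_self M)
      _ = ‖M‖ * (R' / (r / 2)) ^ m := by rw [div_eq_mul_inv R', mul_pow]; ring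
      _ ≤ B m := by
          simp only [hB, if_pos hm]
          exact le_add_of_nonneg_left (by positivity)
  · calc R' ^ m * ‖co m v‖ ≤ R' ^ m * R₂⁻¹ ^ m := by gcongr; exact hbig m hm v hv
      _ = B m := by simp only [hB, if_neg hm.not_gt, div_eq_mul_inv, mul_pow, add_zero]

/-- A separately holomorphic function on an open set is locally bounded. -/
theorem SeparatelyHolomorphicOn.exists_bound {g : ℂ × ℂ → ℂ} {W : Set (ℂ × ℂ)} (hW : IsOpen W)
    (hg : SeparatelyHolomorphicOn g W) {u₀ v₀ : ℂ} (hp : (u₀, v₀) ∈ W) :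
    ∃ δ > 0, ∃ M, ball u₀ δ ×ˢ ball v₀ δ ⊆ W ∧
      ∀ u ∈ ball u₀ δ, ∀ v ∈ ball v₀ δ, ‖g (u, v)‖ ≤ M := by
  obtain ⟨ε, hε, hsub⟩ := Metric.isOpen_iff.1 hW _ hp
  rw [← ball_prod_same] at hsub
  -- Baire yields a centre a within δ of u₀, so `ball u₀ δ` ⊆ `ball a (2 * δ)` and `ball a (3 * δ)`
  -- ⊆ `ball u₀ ε`.
  obtain ⟨δ, hδ, hδε⟩ : ∃ δ > 0, 4 * δ = ε := ⟨ε / 4, by positivity, by ring⟩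
  have hleft : ∀ v ∈ ball v₀ ε, DifferentiableOn ℂ (fun u => g (u, v)) (ball u₀ ε) :=
    fun v hv => (hg.1 v).mono fun u hu => hsub ⟨hu, hv⟩
  have hright : ∀ u ∈ ball u₀ ε, DifferentiableOn ℂ (fun v => g (u, v)) (ball v₀ ε) :=
    fun u hu => (hg.2 u).mono fun v hv => hsub ⟨hu, hv⟩
  have hK : closedBall v₀ (2 * δ) ⊆ ball v₀ ε := closedBall_subset_ball (by linarith)
  have hbaire : ∃ a ∈ ball u₀ δ, ∃ r > 0, r ≤ δ ∧ ∃ M : ℝ,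
      ∀ u ∈ ball a r, ∀ v ∈ closedBall v₀ (2 * δ), ‖g (u, v)‖ ≤ M := by
    set V := ball u₀ δ with hV
    have hVε : V ⊆ ball u₀ ε := ball_subset_ball (by linarith)
    have : BaireSpace V := isOpen_ball.isOpenEmbedding_subtypeVal.baireSpace
    have : Nonempty V := ⟨⟨u₀, mem_ball_self hδ⟩⟩
    -- Closedness uses continuity in u only; covering uses continuity in v on a compact disc.
    have hclosed : ∀ n : ℕ,
        IsClosed {u : V | ∀ v ∈ closedBall v₀ (2 * δ), ‖g (u, v)‖ ≤ n} := fun n => by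
      simp only [Set.ofPred_forall]
      refine isClosed_iInter fun v => isClosed_iInter fun hv => isClosed_le ?_ continuous_const
      exact (continuousOn_iff_continuous_domRestrict.1
        ((hleft v (hK hv)).continuousOn.mono hVε)).norm
    have hcover : ⋃ n : ℕ, {u : V | ∀ v ∈ closedBall v₀ (2 * δ), ‖g (u, v)‖ ≤ n} = univ := by
      refine eq_univ_of_forall fun u => ?_
      obtain ⟨C, hC⟩ := (isCompact_closedBall v₀ (2 * δ)).exists_bound_of_continuousOn
        ((hright u (hVε u.2)).continuousOn.mono hK)
      obtain ⟨n, hn⟩ := exists_nat_ge C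
      exact mem_iUnion.2 ⟨n, fun v hv => (hC v hv).trans hn⟩
    obtain ⟨n, a, ha⟩ := nonempty_interior_of_iUnion_of_closed hclosed hcover
    have hopen := isOpen_ball.isOpenMap_subtype_val _ (isOpen_interior (s :=
      {u : V | ∀ v ∈ closedBall v₀ (2 * δ), ‖g (u, v)‖ ≤ n}))
    obtain ⟨r, hr, hrsub⟩ := Metric.isOpen_iff.1 hopen a ⟨a, ha, rfl⟩
    refine ⟨a, a.2, min r δ, lt_min hr hδ, min_le_right _ _, n, fun u hu v hv => ?_⟩
    obtain ⟨w, hw, rfl⟩ := hrsub (ball_subset_ball (min_le_left _ _) hu)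
    exact interior_subset hw v hv
  obtain ⟨a, ha, r, hr, hrδ, M, hM⟩ := hbaire
  have haε : ball a (3 * δ) ⊆ ball u₀ ε := ball_subset_ball' (by linarith [mem_ball.1 ha])
  have hball : ball v₀ (2 * δ) ⊆ closedBall v₀ (2 * δ) := ball_subset_closedBall
  obtain ⟨M', hM'⟩ := exists_bound_of_separately_holomorphic (g := fun u v => g (u, v)) (a := a)
    (b := v₀) (R := 3 * δ) (R' := 2 * δ) (S := 2 * δ) (S' := δ) hr (by linarith) (by linarith)
    (by linarith) (fun v hv => (hleft v (hK (hball hv))).mono haε)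
    (fun u hu => (hright u (haε (ball_subset_ball (by linarith) hu))).mono (hball.trans hK))
    (fun u hu v hv => hM u hu v (hball hv))
  refine ⟨δ, hδ, M', (Set.prod_mono (ball_subset_ball (by linarith))
    (ball_subset_ball (by linarith))).trans hsub, fun u hu v hv => hM' u ?_ v hv⟩
  have := mem_ball'.1 ha
  have := mem_ball.1 hu
  exact mem_ball.2 (by linarith [dist_triangle u u₀ a])

/-! ### Hermitian symmetry and Cauchy–Schwarz -/

namespace IsPosDefKernelOn

variable {X : Type*} {k : X × X → ℂ} {Ω : Set X}

theorem self_nonneg (hk : IsPosDefKernelOn k Ω) {x : X} (hx : x ∈ Ω) : 0 ≤ k (x, x) := by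
  simpa using hk 1 (fun _ => x) (fun _ => 1) (fun _ => hx)

theorem conj_symm (hk : IsPosDefKernelOn k Ω) {x y : X} (hx : x ∈ Ω) (hy : y ∈ Ω) :
    k (x, y) = conj (k (y, x)) := by
  have hmem : ∀ j, (![x, y] : Fin 2 → X) j ∈ Ω := by
    intro j
    fin_cases j <;> simpa
  have h1 := (Complex.nonneg_iff.1 (hk 2 ![x, y] ![1, 1] hmem)).2
  have h2 := (Complex.nonneg_iff.1 (hk 2 ![x, y] ![1, Complex.I] hmem)).2
  have hxx := (Complex.nonneg_iff.1 (hk.self_nonneg hx)).2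
  have hyy := (Complex.nonneg_iff.1 (hk.self_nonneg hy)).2
  simp [Fin.sum_univ_two] at h1 h2
  apply Complex.ext <;> simp <;> linarith

/-- Cauchy–Schwarz inequality for a positive definite kernel. -/
theorem norm_sum_sq_le (hk : IsPosDefKernelOn k Ω) {n : ℕ} {x : Fin n → X} (ξ : Fin n → ℂ)
    {w : X} (hx : ∀ j, x j ∈ Ω) (hw : w ∈ Ω) :
    ‖∑ i, k (x i, w) * ξ i‖ ^ 2 ≤
      (k (w, w)).re * ‖∑ i, ∑ j, k (x i, x j) * ξ i * conj (ξ j)‖ := by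
  set L := ∑ i, k (x i, w) * ξ i with hL
  set Q := ∑ i, ∑ j, k (x i, x j) * ξ i * conj (ξ j) with hQ
  have hLconj : ∑ j, k (w, x j) * conj (ξ j) = conj L := by
    rw [hL, map_sum]
    exact Finset.sum_congr rfl fun j _ => by rw [map_mul, hk.conj_symm hw (hx j)]
  clear_value L Q
  -- Adjoin w with weight -tL: the cross terms become real and the discriminant applies.
  have hquad : ∀ t : ℝ, 0 ≤ (‖L‖ ^ 2 * (k (w, w)).re) * (t * t) + (-2 * ‖L‖ ^ 2) * t + Q.re := by
    intro t
    have h := hk (n + 1) (Fin.cons w x) (Fin.cons (-(t * L)) ξ) (Fin.cases hw hx)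
    have hexp : ∑ i, ∑ j, k ((Fin.cons w x : Fin (n + 1) → X) i, (Fin.cons w x : Fin (n + 1) → X) j)
        * (Fin.cons (-(t * L)) ξ : Fin (n + 1) → ℂ) i *
          conj ((Fin.cons (-(t * L)) ξ : Fin (n + 1) → ℂ) j) =
        k (w, w) * (t * L) * conj (t * L) - (t * L) * conj L - L * conj (t * L) + Q := by
      simp only [Fin.sum_univ_succ, Fin.cons_zero, Fin.cons_succ, Finset.sum_add_distrib]
      rw [← hQ, ← Finset.sum_mul, ← hL]
      simp only [map_neg, mul_neg, neg_mul, neg_neg, Finset.sum_neg_distrib]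
      have : ∑ j, k (w, x j) * (t * L) * conj (ξ j) = t * L * conj L := by
        rw [← hLconj, Finset.mul_sum]
        exact Finset.sum_congr rfl fun j _ => by ring
      rw [this]
      ring
    rw [hexp] at h
    have hLL : L * conj L = ((‖L‖ ^ 2 : ℝ) : ℂ) := by rw [Complex.mul_conj']; push_cast; rfl
    have : k (w, w) * (t * L) * conj (t * L) - (t * L) * conj L - L * conj (t * L) + Q =
        k (w, w) * ((t * t * ‖L‖ ^ 2 : ℝ) : ℂ) - ((2 * t * ‖L‖ ^ 2 : ℝ) : ℂ) + Q := by
      rw [map_mul, Complex.conj_ofReal]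
      push_cast at hLL ⊢
      linear_combination (k (w, w) * t * t - 2 * t) * hLL
    rw [this] at h
    have h' := (Complex.nonneg_iff.1 h).1
    rw [Complex.add_re, Complex.sub_re, Complex.re_mul_ofReal, Complex.ofReal_re] at h'
    linarith
  have hdisc := discrim_le_zero hquad
  have hQre : Q.re ≤ ‖Q‖ := Complex.re_le_norm Q
  have hw0 : 0 ≤ (k (w, w)).re := (Complex.nonneg_iff.1 (hk.self_nonneg hw)).1
  rcases eq_or_lt_of_le (sq_nonneg ‖L‖) with h0 | h0
  · rw [← h0]
    positivity
  · rw [discrim] at hdisc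
    have h4 : 0 ≤ ‖L‖ ^ 2 * ((k (w, w)).re * Q.re - ‖L‖ ^ 2) := by linarith
    have := nonneg_of_mul_nonneg_right h4 h0
    nlinarith

end IsPosDefKernelOn

/-! ### Convergence of slopes and propagation -/

/-- Difference quotients of a bounded holomorphic function depend on the increment in a Lipschitz
way. -/
theorem norm_slope_sub_slope_le {f : ℂ → ℂ} {c z z' : ℂ} {r M : ℝ}
    (hf : DifferentiableOn ℂ f (ball c r)) (hM : ∀ w ∈ ball c r, ‖f w‖ ≤ M)
    (hz : z ∈ ball c (r / 4)) (hz' : z' ∈ ball c (r / 4)) (hzc : z ≠ c) (hzc' : z' ≠ c) :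
    ‖slope f c z - slope f c z'‖ ≤ 8 * M / r ^ 2 * ‖z - z'‖ := by
  have hr : 0 < r := by
    have := nonempty_ball.1 ⟨z, hz⟩
    linarith
  rw [mem_ball] at hz hz'
  have hsub : ball z' (r / 2) ⊆ ball c r := ball_subset_ball' (by linarith)
  have hD : DifferentiableOn ℂ (dslope f c) (ball c r) :=
    (Complex.differentiableOn_dslope (ball_mem_nhds c hr)).2 hf
  have hzz' : z ∈ ball z' (r / 2) := by
    rw [mem_ball]
    linarith [dist_triangle_right z z' c]
  have := norm_sub_le_of_norm_le_on_ball (hD.mono hsub)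
    (fun w hw => norm_dslope_le_of_norm_le_on_ball hf hM (hsub hw)) hzz'
  rw [dslope_of_ne _ hzc, dslope_of_ne _ hzc'] at this
  refine this.trans_eq ?_
  field_simp
  ring

/-- A complex function whose difference quotients at `c` are Lipschitz is differentiable at `c`. -/
theorem differentiableAt_of_norm_slope_sub_slope_le {f : ℂ → ℂ} {c : ℂ} {r C : ℝ} (hr : 0 < r)
    (h : ∀ z ∈ ball c r, ∀ z' ∈ ball c r, z ≠ c → z' ≠ c →
      ‖slope f c z - slope f c z'‖ ≤ C * ‖z - z'‖) : DifferentiableAt ℂ f c := by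
  have hunif : UniformContinuousOn (slope f c) (ball c r \ {c}) :=
    (LipschitzOnWith.of_dist_le_mul (K := C.toNNReal) fun z hz z' hz' => by
      rw [dist_eq_norm, dist_eq_norm]
      exact (h z hz.1 z' hz'.1 hz.2 hz'.2).trans (by gcongr; exact le_coe_toNNReal C)
      ).uniformContinuousOn
  have hmem : ball c r \ {c} ∈ 𝓝[≠] c :=
    inter_mem (mem_nhdsWithin_of_mem_nhds (ball_mem_nhds c hr)) self_mem_nhdsWithin
  -- Completeness of ℂ supplies the derivative, with no candidate known beforehand.
  have hcauchy : Cauchy (map (slope f c) (𝓝[≠] c)) :=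
    Cauchy.map_of_le (cauchy_nhds.mono nhdsWithin_le_nhds) hunif (le_principal_iff.2 hmem)
  obtain ⟨l, hl⟩ := cauchy_map_iff_exists_tendsto.1 hcauchy
  exact (hasDerivAt_iff_tendsto_slope.2 hl).differentiableAt

/-- If a positive definite kernel is sesquiholomorphic near the diagonal, its sections are
holomorphic. -/
theorem IsPosDefKernelOn.differentiableAt_left {k : ℂ × ℂ → ℂ} {Ω : Set ℂ}
    (hk : IsPosDefKernelOn k Ω) {U : Set (ℂ × ℂ)} (hU : IsOpen U) (hUΩ : U ⊆ Ω ×ˢ Ω)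
    (hsesq : SesquiholomorphicOn k U) {u₀ w : ℂ} (hu₀ : (u₀, u₀) ∈ U) (hw : w ∈ Ω) :
    DifferentiableAt ℂ (fun u => k (u, w)) u₀ := by
  obtain ⟨g, hg, hkg⟩ := hsesq
  have hW : IsOpen (sesquiconjugate U) :=
    hU.preimage (continuous_fst.prodMk (Complex.continuous_conj.comp continuous_snd))
  obtain ⟨δ, hδ, M, hsub, hM⟩ := hg.exists_bound hW (u₀ := u₀) (v₀ := conj u₀)
    (by simpa [sesquiconjugate] using hu₀)
  have hconj : ∀ {ρ : ℝ} {z : ℂ}, z ∈ ball u₀ ρ → conj z ∈ ball (conj u₀) ρ := fun {ρ z} hz => by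
    rwa [mem_ball, Complex.dist_conj_conj]
  have hballU : ∀ u ∈ ball u₀ δ, ∀ v ∈ ball u₀ δ, (u, v) ∈ U := fun u hu v hv => by
    simpa [sesquiconjugate] using hsub (mk_mem_prod hu (hconj hv))
  have hΩ : ∀ u ∈ ball u₀ δ, u ∈ Ω := fun u hu => (hUΩ (hballU u hu u hu)).1
  have hsub4 : ball u₀ (δ / 4) ⊆ ball u₀ δ := ball_subset_ball (by linarith)
  have hc0 : u₀ ∈ ball u₀ δ := mem_ball_self hδ
  have hκ : 0 ≤ (k (w, w)).re := (Complex.nonneg_iff.1 (hk.self_nonneg hw)).1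
  have hM0 : 0 ≤ M := (norm_nonneg _).trans (hM u₀ hc0 _ (hconj hc0))
  refine differentiableAt_of_norm_slope_sub_slope_le (r := δ / 4)
    (C := √(k (w, w)).re * √(8 * (8 * M / δ ^ 2) / δ ^ 2)) (by positivity)
    fun z hz z' hz' hzc hzc' => ?_
  set x : Fin 3 → ℂ := ![z, z', u₀] with hx
  set ξ : Fin 3 → ℂ := ![(z - u₀)⁻¹, -(z' - u₀)⁻¹, (z' - u₀)⁻¹ - (z - u₀)⁻¹] with hξ
  have hxball : ∀ j, x j ∈ ball u₀ δ := by
    intro j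
    fin_cases j
    · exact hsub4 hz
    · exact hsub4 hz'
    · exact hc0
  have hslope : ∀ f : ℂ → ℂ, slope f u₀ z - slope f u₀ z' = ∑ i, f (x i) * ξ i := fun f => by
    simp only [slope_def_module, smul_eq_mul, Fin.sum_univ_three, hx, hξ, Matrix.cons_val]
    ring
  have hslope_conj : ∀ f : ℂ → ℂ, slope f (conj u₀) (conj z) - slope f (conj u₀) (conj z') =
      ∑ i, f (conj (x i)) * conj (ξ i) := fun f => by
    simp only [slope_def_module, smul_eq_mul, Fin.sum_univ_three, hx, hξ, Matrix.cons_val, map_sub,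
      map_neg, map_inv₀]
    ring
  -- Slope difference in the first variable, already O(|z - z'|); the slope estimate applied to G
  -- gives the second factor.
  set G : ℂ → ℂ := fun y => ∑ i, g (x i, y) * ξ i with hG
  have hGbound : ∀ y ∈ ball (conj u₀) δ, ‖G y‖ ≤ 8 * M / δ ^ 2 * ‖z - z'‖ := fun y hy => by
    simp only [hG]
    rw [← hslope fun u => g (u, y)]
    exact norm_slope_sub_slope_le ((hg.1 y).mono fun u hu => hsub (mk_mem_prod hu hy))
      (fun u hu => hM u hu y hy) hz hz' hzc hzc'
  have hGdiff : DifferentiableOn ℂ G (ball (conj u₀) δ) :=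
    DifferentiableOn.fun_sum fun i _ => ((hg.2 (x i)).mono fun y hy =>
      hsub (mk_mem_prod (hxball i) hy)).mul_const _
  have hQ : ‖∑ i, ∑ j, k (x i, x j) * ξ i * conj (ξ j)‖ ≤
      8 * (8 * M / δ ^ 2) / δ ^ 2 * ‖z - z'‖ ^ 2 := by
    have heq : ∑ i, ∑ j, k (x i, x j) * ξ i * conj (ξ j) =
        slope G (conj u₀) (conj z) - slope G (conj u₀) (conj z') := by
      rw [hslope_conj, Finset.sum_comm]
      refine Finset.sum_congr rfl fun j _ => ?_
      rw [hG, Finset.sum_mul]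
      exact Finset.sum_congr rfl fun i _ => by
        rw [hkg _ _ (hballU _ (hxball i) _ (hxball j))]
    rw [heq]
    have hne : ∀ {y : ℂ}, y ≠ u₀ → conj y ≠ conj u₀ := fun h h' => h (star_injective h')
    refine (norm_slope_sub_slope_le hGdiff hGbound (hconj hz) (hconj hz') (hne hzc)
      (hne hzc')).trans_eq ?_
    rw [← map_sub, Complex.norm_conj]
    ring
  rw [hslope fun u => k (u, w)]
  refine (sq_le_sq₀ (norm_nonneg _) (by positivity)).1 ?_
  calc ‖∑ i, k (x i, w) * ξ i‖ ^ 2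
      ≤ (k (w, w)).re * ‖∑ i, ∑ j, k (x i, x j) * ξ i * conj (ξ j)‖ :=
        hk.norm_sum_sq_le ξ (fun j => hΩ _ (hxball j)) hw
    _ ≤ (k (w, w)).re * (8 * (8 * M / δ ^ 2) / δ ^ 2 * ‖z - z'‖ ^ 2) := by gcongr
    _ = _ := by
        rw [mul_pow, mul_pow, sq_sqrt hκ, sq_sqrt (by positivity)]
        ring

/-- **Propagation of regularity**: a positive definite kernel that is sesquiholomorphic near the
diagonal is a holomorphic positive definite kernel. -/
theorem mainTheorem2 (Ω : Set ℂ) (hΩ : IsOpen Ω) (k : ℂ × ℂ → ℂ) (hk : IsPosDefKernelOn k Ω)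
    (U : Set (ℂ × ℂ)) (hU : IsOpen U) (hUΩ : U ⊆ Ω ×ˢ Ω) (hdiag : ∀ x ∈ Ω, (x, x) ∈ U)
    (hsesq : SesquiholomorphicOn k U) :
    IsHolomorphicPosDefKernelOn k Ω := by
  have hleft : ∀ u ∈ Ω, ∀ w ∈ Ω, DifferentiableAt ℂ (fun u => k (u, w)) u := fun u hu w hw =>
    hk.differentiableAt_left hU hUΩ hsesq (hdiag u hu) hw
  refine ⟨hk, fun p => k (p.1, conj p.2), ⟨fun y x hx => ?_, fun x y hy => ?_⟩, fun u v _ => ?_⟩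
  · exact (hleft x hx.1 (conj y) hx.2).differentiableWithinAt
  · obtain ⟨hxΩ, hyΩ⟩ : x ∈ Ω ∧ conj y ∈ Ω := hy
    -- By Hermitian symmetry this function is k(x, conj ·) near y.
    have h1 : DifferentiableAt ℂ (conj ∘ (fun u => k (u, x)) ∘ conj) y :=
      differentiableAt_conj_conj_iff.2 (hleft (conj y) hyΩ x hxΩ)
    refine (h1.congr_of_eventuallyEq ?_).differentiableWithinAt
    have hopen : IsOpen {v : ℂ | conj v ∈ Ω} := hΩ.preimage Complex.continuous_conj
    filter_upwards [hopen.mem_nhds hyΩ] with v hv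
    exact hk.conj_symm hxΩ hv
  · simp
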